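/- Let $\Sigma=\{0,1,2,3\}$. A function $g:\Sigma^m\to\Sigma$ is an $m$-quasigroup (of order 4) if for every $i\in\{1,\dots,m\}$ and all $y,x_1,\dots,x_{i-1},x_{i+1},\dots,x_m\in\Sigma$ there is a unique $x_i\in\Sigma$ with $g(x_1,\dots,x_m)=y$. A line in $\Sigma^m$ is a set of four words that differ only in one fixed coordinate. A set $C\subseteq\Sigma^m$ is an MDS code (respectively, a double-MDS-code) if every line of $\Sigma^m$ contains exactly one (respectively, exactly two) of its elements. A double-MDS-code $S\subseteq\Sigma^m$ is linear if its characteristic function has the form $\chi_S(x_1,\dots,x_m)=\chi_1(x_1)\oplus\dots\oplus\chi_m(x_m)$ for some functions $\chi_i:\Sigma\to\{0,1\}$, where $\oplus$ is addition modulo 2. An MDS code is semilinear if it is a subset of some linear double-MDS-code. An $n$-quasigroup $g$ is semilinear if the MDS code $\{(\bar x,g(\bar x)) : \bar x\in\Sigma^n\}\subseteq\Sigma^{n+1}$ is semilinear. An $n$-quasigroup $g$ is reducible if it is a superposition of quasigroups with fewer than $n$ arguments, that is, $g(\bar x)=g_0(g_1(\tilde x_1),\dots,g_k(\tilde x_k))$,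 where $k<n$, the nonempty collections of variables $\tilde x_1,\dots,\tilde x_k$ partition the variables $x_1,\dots,x_n$, each $\tilde x_j$ consists of $n_j<n$ variables, $g_0$ is a $k$-quasigroup, and each $g_j$ is an $n_j$-quasigroup. Let $n\ge 1$, let $h$ be an $n$-quasigroup, let $\{a,b,c,d\}=\Sigma$, and let $Q$ be the set of all $n$-quasigroups $f$ that coincide with $h$ on $\Sigma^{n-1}\times\{a,b\}$. If $2<|Q|<2^{2^{n-1}}$, then $h$ is reducible. If $|Q|=2^{2^{n-1}}$, then $h$ is semilinear. -/

import Mathlib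

/-- The alphabet `{0,1,2,3}`. -/
abbrev Alphabet : Type := Fin 4

/-- Words over the alphabet whose coordinates are indexed by `ι`
(words of length `n` for `ι = Fin n`). -/
abbrev Word (ι : Type) : Type := ι → Alphabet

/-- A quasigroup of order `4` in the arguments indexed by `ι`
(an `n`-quasigroup for `ι = Fin n`): fixing the value and all arguments but one determines
the remaining argument. -/
def IsQuasigroup {ι : Type} [DecidableEq ι] (g : Word ι → Alphabet) : Prop :=
  ∀ (i : ι) (x : Word ι) (y : Alphabet), ∃! t : Alphabet, g (Function.update x i t) = y

/-- The `i`-line through the word `x`. -/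
def line {ι : Type} [DecidableEq ι] (i : ι) (x : Word ι) : Set (Word ι) :=
  Set.range fun t : Alphabet => Function.update x i t

/-- A (4-ary distance 2) MDS code: every line contains exactly one codeword. -/
def IsMDSCode {ι : Type} [DecidableEq ι] (C : Set (Word ι)) : Prop :=
  ∀ (i : ι) (x : Word ι), (line i x ∩ C).ncard = 1

/-- A double-MDS-code: every line contains exactly two elements of the set. -/
def IsDoubleMDSCode {ι : Type} [DecidableEq ι] (S : Set (Word ι)) : Prop :=
  ∀ (i : ι) (x : Word ι), (line i x ∩ S).ncard = 2

open Classical in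
/-- The characteristic function of a set of words, with values in `{0,1}` read modulo 2. -/
noncomputable def chi {ι : Type} (S : Set (Word ι)) (x : Word ι) : ZMod 2 :=
  if x ∈ S then 1 else 0

/-- A linear double-MDS-code: its characteristic function is the modulo 2 sum of functions
of the single coordinates. -/
def IsLinearDoubleMDSCode {ι : Type} [DecidableEq ι] [Fintype ι] (S : Set (Word ι)) : Prop :=
  IsDoubleMDSCode S ∧
    ∃ c : ι → Alphabet → ZMod 2, ∀ x : Word ι, chi S x = ∑ i, c i (x i)

/-- A semilinear MDS code: an MDS code included in some linear double-MDS-code. -/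
def IsSemilinearCode {ι : Type} [DecidableEq ι] [Fintype ι] (C : Set (Word ι)) : Prop :=
  IsMDSCode C ∧ ∃ S : Set (Word ι), IsLinearDoubleMDSCode S ∧ C ⊆ S

/-- The code `{(x, g(x))}` of length `n + 1` that corresponds to the function `g`. -/
def graphCode {n : ℕ} (g : Word (Fin n) → Alphabet) : Set (Word (Fin (n + 1))) :=
  Set.range fun x : Word (Fin n) => (Fin.snoc x (g x) : Word (Fin (n + 1)))

/-- A semilinear `n`-quasigroup: its MDS code `{(x, g(x))}` is semilinear. -/
def IsSemilinear {n : ℕ} (g : Word (Fin n) → Alphabet) : Prop :=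
  IsSemilinearCode (graphCode g)

/-- A reducible `n`-quasigroup: a superposition
`g(x) = g₀(g₁(x̃₁), …, g_k(x̃_k))` of quasigroups all of whose numbers of arguments are less
than `n`, where `x̃₁, …, x̃_k` are disjoint nonempty collections that exhaust the variables.
The map `p` sends a variable to the number of its collection. -/
def IsReducible {n : ℕ} (g : Word (Fin n) → Alphabet) : Prop :=
  ∃ (k : ℕ) (p : Fin n → Fin k)
    (g₀ : Word (Fin k) → Alphabet) (q : (j : Fin k) → Word {i : Fin n // p i = j} → Alphabet),
    k < n ∧ Function.Surjective p ∧
    (∀ j : Fin k, Fintype.card {i : Fin n // p i = j} < n) ∧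
    IsQuasigroup g₀ ∧ (∀ j : Fin k, IsQuasigroup (q j)) ∧
    ∀ x : Word (Fin n), g x = g₀ fun j => q j fun i => x i.1

/-- The set of the `n`-quasigroups (`n ≥ 1`) that coincide with `h` on all words whose last
letter is `a` or `b`. -/
def agreeingQuasigroups {n : ℕ} (hn : 1 ≤ n) (h : Word (Fin n) → Alphabet) (a b : Alphabet) :
    Set (Word (Fin n) → Alphabet) :=
  {f | IsQuasigroup f ∧
    ∀ x : Word (Fin n), x ⟨n - 1, by omega⟩ ∈ ({a, b} : Set Alphabet) → f x = h x}

/-! Let `g` be the parastrophe of `h` that exchanges the last argument with the value, and colour a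
word `true` when `g` takes a value in `{c, d}` there; every line has two words of either colour. The
parastrophe of a member of `Q` equals `g` off the colour `true`; on each component of that colour
(words joined by changes of one letter) it either equals `g` or has `c` and `d` exchanged. So `|Q| ≤
2 ^ N`, where `N` is the number of components (`ncard_agreeingQuasigroups_le`).

The core is a dichotomy, `faceConnected_insert_or_split`: when a face with connected colour classes
is enlarged by one direction, either the larger face is connected as well, or its layers carry the
same colouring up to complement.

If no two-dimensional face is connected, the colouring splits in every single direction, so it is a
sum modulo 2 of functions of single letters. Then `h` is semilinear and `|Q| ≥ 2 ^ 2 ^ (n - 1)`,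
which excludes the first case of the theorem.

If some two-dimensional face is connected, its component is larger than the minimal size `2 ^ n`,
whence `N < 2 ^ (n - 1)` (`FaceConnected.card_component_lt`) and the second case is excluded.
Enlarge the face to a maximal set `J` of connected directions. If `J` is everything, then `N ≤ 1`
and `|Q| ≤ 2`; otherwise `J` splits off from the colouring, hence from `g`, and `h` is reducible. -/

open Function

/-! ### Quasigroups and their parastrophes -/

section Quasigroups

variable {ι : Type} [DecidableEq ι]

theorem isQuasigroup_iff_injective {g : Word ι → Alphabet} :
    IsQuasigroup g ↔ ∀ (i : ι) (x : Word ι), Injective fun t => g (update x i t) := by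
  constructor
  · intro hg i x s t hst
    exact (hg i x (g (update x i t))).unique hst rfl
  · intro hg i x y
    exact (Finite.injective_iff_bijective.mp (hg i x)).existsUnique y

/-- The inverse of `g` in the argument `i`: the `i`-th letter of the word is read as the value
of `g`, and the missing argument is returned. -/
noncomputable def parastrophe (g : Word ι → Alphabet) (i : ι) (u : Word ι) : Alphabet :=
  Classical.epsilon fun t => g (update u i t) = u i

theorem IsQuasigroup.parastrophe_eq_iff {g : Word ι → Alphabet} (hg : IsQuasigroup g) (i : ι)
    (u : Word ι) (z : Alphabet) : parastrophe g i u = z ↔ g (update u i z) = u i := by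
  have h1 : g (update u i (parastrophe g i u)) = u i :=
    Classical.epsilon_spec (hg i u (u i)).exists
  constructor
  · rintro rfl
    exact h1
  · intro h
    exact (hg i u (u i)).unique h1 h

theorem IsQuasigroup.apply_parastrophe {g : Word ι → Alphabet} (hg : IsQuasigroup g) (i : ι)
    (u : Word ι) : g (update u i (parastrophe g i u)) = u i :=
  (hg.parastrophe_eq_iff i u _).mp rfl

theorem IsQuasigroup.parastrophe_update {g : Word ι → Alphabet} (hg : IsQuasigroup g) (i : ι)
    (x : Word ι) : parastrophe g i (update x i (g x)) = x i := by
  rw [hg.parastrophe_eq_iff]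
  simp

theorem IsQuasigroup.apply_eq_iff {g : Word ι → Alphabet} (hg : IsQuasigroup g) (i : ι)
    (x : Word ι) (y : Alphabet) : g x = y ↔ parastrophe g i (update x i y) = x i := by
  rw [hg.parastrophe_eq_iff]
  simp

theorem IsQuasigroup.isQuasigroup_parastrophe {g : Word ι → Alphabet} (hg : IsQuasigroup g) (i : ι) :
    IsQuasigroup (parastrophe g i) := by
  rw [isQuasigroup_iff_injective]
  intro j u s t hst
  have h1 := hg.apply_parastrophe i (update u j s)
  have h2 := hg.apply_parastrophe i (update u j t)
  simp only at hst
  rw [hst] at h1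
  by_cases hij : j = i
  · subst hij
    simp only [update_idem, update_self] at h1 h2
    rw [← h1, h2]
  · rw [update_comm hij, update_of_ne (Ne.symm hij)] at h1 h2
    exact isQuasigroup_iff_injective.mp hg j _ (h1.trans h2.symm)

end Quasigroups

/-! ### Balanced two-colourings and connected faces -/

section Colourings

variable {ι : Type} [DecidableEq ι]

/-- A two-colouring of the words such that every line has two words of either colour. -/
def IsBalanced (χ : Word ι → Bool) : Prop :=
  ∀ (i : ι) (u : Word ι) (b : Bool),
    (Finset.univ.filter fun t : Alphabet => χ (update u i t) = b).card = 2

/-- Two words of the same colour that differ at most in one coordinate from `I`. -/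
def Step (χ : Word ι → Bool) (I : Finset ι) (u v : Word ι) : Prop :=
  ∃ i ∈ I, ∃ t : Alphabet, v = update u i t ∧ χ v = χ u

/-- Words that are joined by a chain of steps. -/
abbrev Reach (χ : Word ι → Bool) (I : Finset ι) : Word ι → Word ι → Prop :=
  Relation.ReflTransGen (Step χ I)

/-- Within the face through `α` with the directions from `I`, any two words of the same colour
are joined by a chain of steps. -/
def FaceConnected (χ : Word ι → Bool) (I : Finset ι) (α : Word ι) : Prop :=
  ∀ u v : Word ι, (∀ i ∉ I, u i = α i) → (∀ i ∉ I, v i = α i) → χ u = χ v → Reach χ I u v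

variable {χ : Word ι → Bool} {I : Finset ι}

theorem Step.symm {u v : Word ι} (h : Step χ I u v) : Step χ I v u := by
  obtain ⟨i, hi, t, rfl, h⟩ := h
  exact ⟨i, hi, u i, by simp, h.symm⟩

theorem Reach.symm {u v : Word ι} (h : Reach χ I u v) : Reach χ I v u :=
  have : Std.Symm (Step χ I) := ⟨fun _ _ => Step.symm⟩
  Relation.ReflTransGen.stdSymm.symm _ _ h

theorem Reach.mono {J : Finset ι} (hIJ : I ⊆ J) {u v : Word ι} (h : Reach χ I u v) :
    Reach χ J u v :=
  Relation.ReflTransGen.mono (fun _ _ ⟨i, hi, t, h⟩ => ⟨i, hIJ hi, t, h⟩) _ _ h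

theorem Reach.colour_eq {u v : Word ι} (h : Reach χ I u v) : χ u = χ v := by
  induction h with
  | refl => rfl
  | tail _ h ih =>
    obtain ⟨i, hi, t, -, h⟩ := h
    exact ih.trans h.symm

theorem IsBalanced.exists_ne (hχ : IsBalanced χ) (i : ι) (u : Word ι) :
    ∃ t, t ≠ u i ∧ χ (update u i t) = χ u := by
  have h := hχ i u (χ u)
  obtain ⟨t, ht, hne⟩ := Finset.exists_mem_ne (h ▸ Nat.one_lt_two) (u i)
  exact ⟨t, hne, (Finset.mem_filter.mp ht).2⟩

theorem IsBalanced.exists_colour (hχ : IsBalanced χ) (i : ι) (u : Word ι) (b : Bool) :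
    ∃ t, χ (update u i t) = b := by
  have h := hχ i u b
  obtain ⟨t, ht⟩ := Finset.card_pos.mp (h ▸ Nat.two_pos)
  exact ⟨t, (Finset.mem_filter.mp ht).2⟩

theorem IsBalanced.eq_of_colour_eq (hχ : IsBalanced χ) {i : ι} {u : Word ι} {s t : Alphabet}
    (hs : s ≠ u i) (ht : t ≠ u i) (hsu : χ (update u i s) = χ u)
    (htu : χ (update u i t) = χ u) : s = t := by
  by_contra hst
  have h := hχ i u (χ u)
  have : ({u i, s, t} : Finset Alphabet) ⊆
      Finset.univ.filter fun t : Alphabet => χ (update u i t) = χ u := by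
    intro r hr
    simp only [Finset.mem_insert, Finset.mem_singleton] at hr
    rcases hr with rfl | rfl | rfl <;> simp [hsu, htu]
  have h3 := Finset.card_le_card this
  rw [Finset.card_eq_three.mpr ⟨u i, s, t, hs.symm, ht.symm, hst, rfl⟩] at h3
  omega

/-- If all words of one colour that lie over some line are of the colour `b` in another line,
then these are the only ones. -/
theorem IsBalanced.colour_eq_of_imp (hχ : IsBalanced χ) {i j : ι} {u v : Word ι} {b b' : Bool}
    (h : ∀ t, χ (update u i t) = b → χ (update v j t) = b') (t : Alphabet)
    (ht : χ (update v j t) = b') : χ (update u i t) = b := by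
  have h1 := Finset.eq_of_subset_of_card_le
    (s := Finset.univ.filter fun t : Alphabet => χ (update u i t) = b)
    (t := Finset.univ.filter fun t : Alphabet => χ (update v j t) = b')
    (fun t ht => by simpa using h t (by simpa using ht)) (by rw [hχ, hχ])
  have h2 : t ∈ Finset.univ.filter fun t : Alphabet => χ (update v j t) = b' := by simpa using ht
  rw [← h1] at h2
  simpa using h2

theorem faceConnected_singleton (χ : Word ι → Bool) (i : ι) (α : Word ι) :
    FaceConnected χ {i} α := by
  intro u v hu hv huv
  refine Relation.ReflTransGen.single ⟨i, by simp, v i, ?_, huv.symm⟩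
  ext j
  by_cases hj : j = i
  · subst hj; simp
  · rw [update_of_ne hj, hu j (by simpa using hj), hv j (by simpa using hj)]

/-- A connected face is connected to its parallel faces in the direction `j`, or the colouring
splits in the direction `j`. -/
theorem faceConnected_insert_or_split (hχ : IsBalanced χ) (hI : I.Nonempty) {j : ι} (hj : j ∉ I)
    {α : Word ι} (hc : FaceConnected χ I α) :
    FaceConnected χ (insert j I) α ∨
      ∀ u v : Word ι, (∀ i ∉ I, u i = α i) → (∀ i ∉ I, v i = α i) → ∀ t,
        (χ u = χ v ↔ χ (update u j t) = χ (update v j t)) := by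
  -- Either every word of the larger face can be joined to the given face, or some `p` cannot.
  by_cases hR : ∀ p : Word ι, (∀ i ∉ insert j I, p i = α i) →
      ∃ q : Word ι, (∀ i ∉ I, q i = α i) ∧ χ q = χ p ∧ Reach χ (insert j I) p q
  · left
    intro u v hu hv huv
    obtain ⟨p, hp, hpu, hup⟩ := hR u hu
    obtain ⟨q, hq, hqv, hvq⟩ := hR v hv
    have hpq := (hc p q hp hq (by rw [hpu, huv, hqv])).mono (Finset.subset_insert j I)
    exact hup.trans (hpq.trans hvq.symm)
  right
  push Not at hR
  obtain ⟨p, hp, hR⟩ := hR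
  have hjne : ∀ i ∈ I, i ≠ j := fun i hi h => hj (h ▸ hi)
  have hα : ∀ v : Word ι, (∀ i ∉ I, v i = α i) → ∀ t, update (update v j t) j (α j) = v := by
    intro v hv t
    rw [update_idem, ← hv j hj, update_eq_self]
  have hupd : ∀ v : Word ι, (∀ i ∉ I, v i = α i) → ∀ i ∈ I, ∀ r,
      ∀ k ∉ I, update v i r k = α k := by
    intro v hv i hi r k hk
    rw [update_of_ne (by rintro rfl; exact hk hi), hv k hk]
  have hbad : ∀ v : Word ι, (∀ i ∉ I, v i = α i) → ∀ t, Reach χ (insert j I) p (update v j t) →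
      χ v ≠ χ p := by
    intro v hv t h1 hvp
    refine hR v hv hvp (h1.tail ⟨j, by simp, α j, (hα v hv t).symm, ?_⟩)
    rw [hvp, ← h1.colour_eq]
  have hp' : ∀ i ∉ I, update p j (α j) i = α i := by
    intro i hi
    by_cases hij : i = j
    · subst hij; simp
    · rw [update_of_ne hij, hp i (by simp [hij, hi])]
  -- In a layer where `p` keeps its colour, reachable words lie only over base words of the other
  -- colour (`hbad`), and that class is connected in the base. A chain there lifts to the layer: the
  -- unique partner of a lifted word on its line projects to a base word of the same class, hence to
  -- the partner of `v`.
  have hspread : ∀ t, χ (update p j t) = χ p → ∀ v : Word ι, (∀ i ∉ I, v i = α i) →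
      χ v ≠ χ p → Reach χ (insert j I) p (update v j t) := by
    intro t ht v hv hvp
    have h0 : Reach χ (insert j I) p (update (update p j (α j)) j t) := by
      rw [update_idem]
      exact .single ⟨j, by simp, t, rfl, ht⟩
    have h1 := hbad _ hp' t h0
    have h2 : χ (update p j (α j)) = χ v := by
      revert h1 hvp
      cases χ (update p j (α j)) <;> cases χ v <;> cases χ p <;> simp
    have h3 := hc _ v hp' hv h2
    suffices (∀ i ∉ I, v i = α i) ∧ Reach χ (insert j I) p (update v j t) from this.2
    clear hvp hv h2
    induction h3 with
    | refl => exact ⟨hp', h0⟩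
    | @tail v w hvw hs ih =>
      obtain ⟨hv, ih⟩ := ih
      obtain ⟨i, hi, r, rfl, hr⟩ := hs
      refine ⟨hupd v hv i hi r, ?_⟩
      by_cases hrv : r = v i
      · rwa [hrv, update_eq_self]
      obtain ⟨s, hs, hsv⟩ := hχ.exists_ne i (update v j t)
      rw [update_of_ne (hjne i hi)] at hs
      have h4 : Reach χ (insert j I) p (update (update v i s) j t) := by
        rw [update_comm (hjne i hi)]
        exact ih.tail ⟨i, by simp [hi], s, rfl, hsv⟩
      have h5 := hbad _ (hupd v hv i hi s) t h4
      have h6 := hbad v hv t ih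
      have h7 : χ (update v i s) = χ v := by
        revert h5 h6
        cases χ (update v i s) <;> cases χ v <;> cases χ p <;> simp
      rwa [hχ.eq_of_colour_eq hrv hs hr h7]
  -- By `hspread` the layer is flipped over one base colour; counting two words per line forces the
  -- flip over the other.
  have hflip : ∀ t, χ (update p j t) = χ p → ∀ v : Word ι, (∀ i ∉ I, v i = α i) →
      χ (update v j t) = !χ v := by
    intro t ht v hv
    have key : ∀ v : Word ι, (∀ i ∉ I, v i = α i) → χ v ≠ χ p → χ (update v j t) = χ p :=
      fun v hv hvp => (hspread t ht v hv hvp).colour_eq.symm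
    by_cases hvp : χ v = χ p
    · by_contra hne
      have hvt : χ (update v j t) = χ p := by
        revert hne hvp
        cases χ (update v j t) <;> cases χ v <;> cases χ p <;> simp
      obtain ⟨i, hi⟩ := hI
      have := hχ.colour_eq_of_imp (i := i) (j := i) (u := v) (v := update v j t) (b := !χ p)
        (b' := χ p) (fun r hr => by
          rw [← update_comm (hjne i hi)]
          exact key _ (hupd v hv i hi r) (by rw [hr]; simp)) (v i)
        (by rw [← hvt]; congr 1; rw [← update_of_ne (hjne i hi) t v, update_eq_self])
      rw [update_eq_self, hvp] at this
      simp at this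
    · rw [key v hv hvp]
      revert hvp
      cases χ v <;> cases χ p <;> simp
  -- The two flipped layers use up both words of the colour opposite to `v` on its line in direction
  -- `j`.
  have hstay : ∀ t, χ (update p j t) ≠ χ p → ∀ v : Word ι, (∀ i ∉ I, v i = α i) →
      χ (update v j t) = χ v := by
    intro t ht v hv
    by_contra hne
    exact ht (hχ.colour_eq_of_imp (fun t ht => hflip t ht v hv) t (by
      revert hne
      cases χ (update v j t) <;> cases χ v <;> simp))
  intro u v hu hv t
  by_cases ht : χ (update p j t) = χ p
  · rw [hflip t ht u hu, hflip t ht v hv]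
    simp
  · rw [hstay t ht u hu, hstay t ht v hv]

end Colourings

/-! ### Maximal connected faces and splitting off -/

section Splitting

/-- The words at which `g` takes one of the values `c`, `d`. -/
def valueColour {ι : Type} (g : Word ι → Alphabet) (c d : Alphabet) (u : Word ι) : Bool :=
  decide (g u = c ∨ g u = d)

theorem eq_iff_ne_of_valueColour {ι : Type} {g : Word ι → Alphabet} {c d : Alphabet} {u v w : Word ι}
    (huv : valueColour g c d u = valueColour g c d v) (hcd : c ≠ d)
    (hvw : valueColour g c d w = valueColour g c d v) (hne : g v ≠ g w) :
    g u = g v ↔ ¬ g u = g w := by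
  unfold valueColour at *
  generalize g u = p at *
  generalize g v = q at *
  generalize g w = r at *
  revert c d p q r
  decide

variable {ι : Type} [DecidableEq ι]

theorem word_induction [Fintype ι] {P : Word ι → Prop} (α : Word ι) (h : P α)
    (hs : ∀ β j t, P β → P (update β j t)) (β : Word ι) : P β := by
  suffices ∀ T : Finset ι, P (T.piecewise β α) by simpa using this Finset.univ
  intro T
  induction T using Finset.induction_on with
  | empty => simpa using h
  | insert j T _ ih =>
    rw [Finset.piecewise_insert]
    exact hs _ _ _ ih

/-- Whether `f` takes equal values on two words that coincide outside `I` depends only on the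
letters of these words in `I`. -/
def SplitsOff {β : Type} (f : Word ι → β) (I : Finset ι) : Prop :=
  ∀ u v w z : Word ι, (∀ i ∉ I, u i = v i) → (∀ i ∉ I, w i = z i) → (∀ i ∈ I, u i = w i) →
    (∀ i ∈ I, v i = z i) → (f u = f v ↔ f w = f z)

variable {χ : Word ι → Bool} {I : Finset ι}

/-- Since the enlarged face is not connected, the dichotomy says that passing to another layer
preserves equality of colours, so chains of steps carry over to that layer. -/
theorem FaceConnected.split_update (hχ : IsBalanced χ) (hI : I.Nonempty) {β : Word ι}
    (hβ : FaceConnected χ I β) {j : ι} (hj : j ∉ I) (hn : ¬ FaceConnected χ (insert j I) β)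
    (t : Alphabet) : FaceConnected χ I (update β j t) ∧
      ∀ w z : Word ι, (∀ i ∉ I, w i = update β j t i) →
        (∀ i ∉ I, z i = update β j t i) →
        (χ (update w j (β j)) = χ (update z j (β j)) ↔ χ w = χ z) := by
  have hs := (faceConnected_insert_or_split hχ hI hj hβ).resolve_left hn
  have hback : ∀ w : Word ι, (∀ i ∉ I, w i = update β j t i) →
      ∀ i ∉ I, update w j (β j) i = β i := by
    intro w hw i hi
    by_cases hij : i = j
    · subst hij; simp
    · rw [update_of_ne hij, hw i hi, update_of_ne hij]
  have hforth : ∀ w : Word ι, (∀ i ∉ I, w i = update β j t i) →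
      update (update w j (β j)) j t = w := by
    intro w hw
    have : w j = t := by rw [hw j hj, update_self]
    rw [update_idem, ← this, update_eq_self]
  have hsplit : ∀ w z : Word ι, (∀ i ∉ I, w i = update β j t i) →
        (∀ i ∉ I, z i = update β j t i) →
        (χ (update w j (β j)) = χ (update z j (β j)) ↔ χ w = χ z) := by
    intro w z hw hz
    rw [hs _ _ (hback w hw) (hback z hz) t, hforth w hw, hforth z hz]
  refine ⟨?_, hsplit⟩
  intro w z hw hz hwz
  have hr := hβ _ _ (hback w hw) (hback z hz) ((hsplit w z hw hz).mpr hwz)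
  suffices ∀ p q, Reach χ I p q → (∀ i ∉ I, p i = β i) →
      (∀ i ∉ I, q i = β i) ∧ Reach χ I (update p j t) (update q j t) by
    have := (this _ _ hr (hback w hw)).2
    rwa [hforth w hw, hforth z hz] at this
  intro p q hpq hp
  induction hpq with
  | refl => exact ⟨hp, .refl⟩
  | @tail q r _ hqr ih =>
    obtain ⟨hq, ih⟩ := ih
    obtain ⟨i, hi, s, rfl, hc⟩ := hqr
    have hij : i ≠ j := by rintro rfl; exact hj hi
    have hr : ∀ k ∉ I, update q i s k = β k := by
      intro k hk
      rw [update_of_ne (by rintro rfl; exact hk hi), hq k hk]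
    refine ⟨hr, ih.tail ⟨i, hi, s, update_comm hij _ _ _, ?_⟩⟩
    exact (hs _ _ hr hq t).mp hc

/-- Every face with directions `I` is reached by changing letters one at a time, and maximality
rules out the connected alternative at each change outside `I`. -/
theorem splitsOff_of_maximal [Fintype ι] (hχ : IsBalanced χ) (hI : I.Nonempty) {α : Word ι}
    (hα : FaceConnected χ I α)
    (hmax : ∀ j ∉ I, ∀ β, ¬ FaceConnected χ (insert j I) β) :
    SplitsOff χ I ∧ ∀ β, FaceConnected χ I β := by
  have key : ∀ β, FaceConnected χ I β ∧ ∀ u v w z : Word ι, (∀ i ∉ I, u i = α i) →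
      (∀ i ∉ I, v i = α i) → (∀ i ∉ I, w i = β i) → (∀ i ∉ I, z i = β i) →
      (∀ i ∈ I, u i = w i) → (∀ i ∈ I, v i = z i) → (χ u = χ v ↔ χ w = χ z) := by
    refine word_induction α ⟨hα, ?_⟩ ?_
    · intro u v w z hu hv hw hz huw hvz
      have h1 : u = w := by
        ext i
        by_cases hi : i ∈ I
        · rw [huw i hi]
        · rw [hu i hi, hw i hi]
      have h2 : v = z := by
        ext i
        by_cases hi : i ∈ I
        · rw [hvz i hi]
        · rw [hv i hi, hz i hi]
      rw [h1, h2]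
    · rintro β j t ⟨hβ, ih⟩
      by_cases hj : j ∈ I
      · have hne : ∀ i ∉ I, update β j t i = β i := by
          intro i hi
          rw [update_of_ne (by rintro rfl; exact hi hj)]
        constructor
        · intro u v hu hv
          exact hβ u v (fun i hi => (hu i hi).trans (hne i hi))
            fun i hi => (hv i hi).trans (hne i hi)
        · intro u v w z hu hv hw hz
          exact ih u v w z hu hv (fun i hi => (hw i hi).trans (hne i hi))
            fun i hi => (hz i hi).trans (hne i hi)
      · obtain ⟨h1, h2⟩ := hβ.split_update hχ hI hj (hmax j hj β) t
        refine ⟨h1, ?_⟩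
        intro u v w z hu hv hw hz huw hvz
        have hface : ∀ w : Word ι, (∀ i ∉ I, w i = update β j t i) →
            ∀ i ∉ I, update w j (β j) i = β i := by
          intro w hw i hi
          by_cases hij : i = j
          · subst hij; simp
          · rw [update_of_ne hij, hw i hi, update_of_ne hij]
        rw [← h2 w z hw hz]
        refine ih u v _ _ hu hv (hface w hw) (hface z hz) ?_ ?_
        · intro i hi
          rw [update_of_ne (by rintro rfl; exact hj hi), huw i hi]
        · intro i hi
          rw [update_of_ne (by rintro rfl; exact hj hi), hvz i hi]
  refine ⟨?_, fun β => (key β).1⟩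
  intro u v w z huv hwz huw hvz
  have hp : ∀ u : Word ι, (∀ i ∉ I, I.piecewise u α i = α i) ∧ ∀ i ∈ I, I.piecewise u α i = u i :=
    fun u => ⟨fun i hi => by simp [hi], fun i hi => by simp [hi]⟩
  rw [← (key u).2 (I.piecewise u α) (I.piecewise v α) u v (hp u).1 (hp v).1 (fun _ _ => rfl)
      (fun i hi => (huv i hi).symm) (hp u).2 (hp v).2,
    (key w).2 (I.piecewise u α) (I.piecewise v α) w z (hp u).1 (hp v).1 (fun _ _ => rfl)
      (fun i hi => (hwz i hi).symm) (fun i hi => ((hp u).2 i hi).trans (huw i hi))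
      (fun i hi => ((hp v).2 i hi).trans (hvz i hi))]

/-- Every connected face lies in one whose directions split off. -/
theorem FaceConnected.exists_splitsOff [Fintype ι] (hχ : IsBalanced χ) (hI : I.Nonempty)
    {α : Word ι} (hα : FaceConnected χ I α) :
    ∃ J, I ⊆ J ∧ SplitsOff χ J ∧ ∀ β, FaceConnected χ J β := by
  obtain ⟨J, hIJ, ⟨β, hβ⟩, hmax⟩ :=
    Finite.exists_le_maximal (p := fun J : Finset ι => ∃ β, FaceConnected χ J β) ⟨α, hα⟩
  refine ⟨J, hIJ, splitsOff_of_maximal hχ (hI.mono hIJ) hβ ?_⟩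
  intro j hj β hβ
  exact hj (hmax ⟨β, hβ⟩ (Finset.subset_insert j J) (Finset.mem_insert_self j J))

/-- A line is always connected, so a direction that does not split off cannot be maximal. -/
theorem splitsOff_singleton_or_faceConnected [Fintype ι] (hχ : IsBalanced χ) :
    (∀ i, SplitsOff χ {i}) ∨ ∃ i j α, i ≠ j ∧ FaceConnected χ {i, j} α := by
  by_contra! h
  obtain ⟨⟨i, hi⟩, h⟩ := h
  refine hi (splitsOff_of_maximal hχ (Finset.singleton_nonempty i)
    (faceConnected_singleton χ i fun _ => 0) ?_).1
  intro j hj β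
  exact h j i β (by simpa using hj)

theorem IsQuasigroup.isBalanced_valueColour {g : Word ι → Alphabet} (hg : IsQuasigroup g)
    {c d : Alphabet} (hcd : c ≠ d) : IsBalanced (valueColour g c d) := by
  intro i u b
  have hinj := isQuasigroup_iff_injective.mp hg i u
  have h1 : (Finset.univ.filter fun t : Alphabet => valueColour g c d (update u i t) = b).image
      (fun t => g (update u i t)) = Finset.univ.filter fun y => decide (y = c ∨ y = d) = b := by
    ext y
    simp only [Finset.mem_image, Finset.mem_filter, Finset.mem_univ, true_and]
    constructor
    · rintro ⟨t, ht, rfl⟩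
      exact ht
    · intro hy
      obtain ⟨t, ht⟩ := (hg i u y).exists
      refine ⟨t, ?_, ht⟩
      rw [valueColour, ht, hy]
  rw [← Finset.card_image_of_injective _ hinj, h1]
  clear h1 hinj
  revert b c d
  decide

/-- If the words with values in `{c, d}` split off `I` and the faces with the directions `I` are
connected, then `g` itself splits off `I`. -/
theorem IsQuasigroup.splitsOff {g : Word ι → Alphabet} (hg : IsQuasigroup g) {c d : Alphabet}
    (hcd : c ≠ d) (hs : SplitsOff (valueColour g c d) I)
    (hI : ∀ β, FaceConnected (valueColour g c d) I β) : SplitsOff g I := by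
  suffices ∀ u v w z : Word ι, (∀ i ∉ I, u i = v i) → (∀ i ∉ I, w i = z i) →
      (∀ i ∈ I, u i = w i) → (∀ i ∈ I, v i = z i) →
      valueColour g c d u = valueColour g c d v → (g u = g v ↔ g w = g z) by
    intro u v w z huv hwz huw hvz
    by_cases hc : valueColour g c d u = valueColour g c d v
    · exact this u v w z huv hwz huw hvz hc
    · have hc' := (hs u v w z huv hwz huw hvz).not.mp hc
      have h1 : ∀ p q : Word ι, valueColour g c d p ≠ valueColour g c d q → g p ≠ g q := by
        intro p q hpq h
        exact hpq (by simp [valueColour, h])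
      simp [h1 _ _ hc, h1 _ _ hc']
  intro u v w z huv hwz huw hvz hc
  have hr := hI v u v huv (fun _ _ => rfl) hc
  have hpz : I.piecewise v w = z := by
    ext i
    by_cases hi : i ∈ I
    · simp [hi, hvz i hi]
    · simp [hi, hwz i hi]
  rw [← hpz]
  clear hpz hwz hvz hc z
  suffices (∀ i ∉ I, u i = v i) ∧ (g u = g v ↔ g w = g (I.piecewise v w)) from this.2
  clear huv
  have hw : ∀ i ∉ I, w i = I.piecewise u w i := fun i hi => by simp [hi]
  -- The chain is copied into the face of `w`. A step that changes the word swaps the two values of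
  -- its colour class in both faces, so both comparisons depend only on the parity of the number of
  -- such steps.
  induction hr with
  | refl =>
    have : I.piecewise u w = w := by
      ext i
      by_cases hi : i ∈ I
      · simp [hi, huw i hi]
      · simp [hi]
    simp [this]
  | @tail p q hup hpq ih =>
    obtain ⟨hp, ih⟩ := ih
    have hcu := Reach.colour_eq hup
    obtain ⟨i, hi, t, rfl, hc⟩ := hpq
    have hq : ∀ k ∉ I, p k = update p i t k := by
      intro k hk
      rw [update_of_ne (by rintro rfl; exact hk hi)]
    refine ⟨fun k hk => (hp k hk).trans (hq k hk), ?_⟩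
    by_cases ht : t = p i
    · rwa [ht, update_eq_self]
    have hpw : I.piecewise (update p i t) w = update (I.piecewise p w) i t := by
      ext k
      by_cases hki : k = i
      · subst hki; simp [hi]
      · by_cases hk : k ∈ I <;> simp [hk, hki]
    have hon : ∀ p : Word ι, ∀ k ∈ I, p k = I.piecewise p w k := fun p k hk => by simp [hk]
    have hoff : ∀ p q : Word ι, ∀ k ∉ I, I.piecewise p w k = I.piecewise q w k :=
      fun p q k hk => by simp [hk]
    have hcw := (hs _ _ _ _ hp (hoff u p) (hon u) (hon p)).mp hcu
    have hc2 := (hs _ _ _ _ hq (hoff _ _) (hon p) (hon (update p i t))).mp hc.symm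
    have huw' : I.piecewise u w = w := by
      ext k
      by_cases hk : k ∈ I
      · simp [hk, huw k hk]
      · simp [hk]
    rw [huw'] at hcw
    have hne : ∀ p : Word ι, t ≠ p i → g p ≠ g (update p i t) := by
      intro p ht h
      have := isQuasigroup_iff_injective.mp hg i p
      exact ht (this (by simpa using h)).symm
    have hne2 := hne (I.piecewise p w) (by simpa [hi] using ht)
    rw [← hpw] at hne2
    have e1 := eq_iff_ne_of_valueColour hcu hcd hc (hne p ht)
    have e2 := eq_iff_ne_of_valueColour hcw hcd hc2.symm hne2
    tauto

end Splitting

/-! ### From splitting off to superpositions -/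

section Reducibility

variable {n : ℕ}

/-- If `h` factors over a function `G` of the variables from `J` and the other variables, then it
is reducible. -/
theorem IsQuasigroup.isReducible {h : Word (Fin n) → Alphabet} (hh : IsQuasigroup h)
    {J : Finset (Fin n)} (hJ : 2 ≤ J.card) (hJn : J.card < n) (G : Word (Fin n) → Alphabet)
    (hG : ∀ x y : Word (Fin n), (∀ i ∈ J, x i = y i) → G x = G y)
    (hGh : ∀ x y : Word (Fin n), (∀ i ∉ J, x i = y i) → G x = G y → h x = h y) :
    IsReducible h := by
  have hinj := isQuasigroup_iff_injective.mp hh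
  have hGinj : ∀ i ∈ J, ∀ x, Injective fun t => G (update x i t) := by
    intro i hi x s t hst
    refine hinj i x (hGh _ _ ?_ hst)
    intro k hk
    rw [update_of_ne (by rintro rfl; exact hk hi), update_of_ne (by rintro rfl; exact hk hi)]
  obtain ⟨j, hj⟩ : J.Nonempty := Finset.card_pos.mp (by omega)
  have hsolve : ∀ x y, ∃ t, G (update x j t) = y := fun x =>
    (Finite.injective_iff_surjective.mp (hGinj j hj x))
  choose τ hτ using hsolve
  have hcard : Fintype.card {i // i ∉ J} = n - J.card := by
    rw [Fintype.card_subtype_compl, Fintype.card_fin, Fintype.card_coe]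
  let e : {i // i ∉ J} ≃ Fin (n - J.card) := Fintype.equivFinOfCardEq hcard
  -- Class `0` is `J`, every other class is a single variable; `2 ≤ J.card` makes the number of
  -- classes less than `n`.
  let p : Fin n → Fin (n - J.card + 1) := fun i => if hi : i ∈ J then 0 else (e ⟨i, hi⟩).succ
  have hp0 : ∀ i, p i = 0 ↔ i ∈ J := by
    intro i
    by_cases hi : i ∈ J <;> simp [p, hi, Fin.succ_ne_zero]
  have hpinj : ∀ i k, i ∉ J → p i = p k → i = k := by
    intro i k hi hik
    have hk : k ∉ J := fun hk => hi ((hp0 i).mp (hik.trans ((hp0 k).mpr hk)))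
    simpa [p, hi, hk] using hik
  have hp : Surjective p := by
    intro m
    induction m using Fin.cases with
    | zero => exact ⟨j, (hp0 j).mpr hj⟩
    | succ m => exact ⟨(e.symm m).1, by simp [p, (e.symm m).2]⟩
  choose r hr using hp
  -- The outer quasigroup is `h` at a representative `X y`: letters in `J` are `0`, except that the
  -- `j`-th is solved for so that `G` takes the value `y 0`.
  let B : Word (Fin (n - J.card + 1)) → Word (Fin n) := fun y i => if i ∈ J then 0 else y (p i)
  let X : Word (Fin (n - J.card + 1)) → Word (Fin n) := fun y => update (B y) j (τ (B y) (y 0))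
  have hXG : ∀ y, G (X y) = y 0 := fun y => hτ _ _
  have hX : ∀ y, ∀ i ∉ J, X y i = y (p i) := by
    intro y i hi
    simp only [X]
    rw [update_of_ne (by rintro rfl; exact hi hj)]
    simp [B, hi]
  let q : (m : Fin (n - J.card + 1)) → Word {i : Fin n // p i = m} → Alphabet := fun m w =>
    if m = 0 then G (fun i => if hi : p i = m then w ⟨i, hi⟩ else 0) else w ⟨r m, hr m⟩
  refine ⟨n - J.card + 1, p, fun y => h (X y), q, by omega, fun m => ⟨r m, hr m⟩, ?_, ?_, ?_, ?_⟩
  · intro m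
    rw [Fintype.card_subtype]
    by_cases hm : m = 0
    · subst hm
      simpa [hp0] using hJn
    · refine lt_of_le_of_lt (Finset.card_le_one.mpr ?_) (by omega)
      intro a ha b hb
      simp only [Finset.mem_filter, Finset.mem_univ, true_and] at ha hb
      exact hpinj a b (fun h => hm (ha ▸ (hp0 a).mpr h)) (ha.trans hb.symm)
  · rw [isQuasigroup_iff_injective]
    intro m y s t hst
    simp only at hst
    by_cases hm : m = 0
    · subst hm
      have hB : ∀ t, B (update y 0 t) = B y := by
        intro t
        ext i
        by_cases hi : i ∈ J
        · simp [B, hi]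
        · simp [B, hi, hp0]
      simp only [X, hB, update_self] at hst
      have := hinj j _ hst
      rw [← hτ (B y) s, this, hτ]
    · have hi : r m ∉ J := fun h => hm ((hr m) ▸ (hp0 _).mpr h)
      have hBu : ∀ t, ∀ k, k ≠ r m → B (update y m t) k = B y k := by
        intro t k hk
        by_cases hkJ : k ∈ J
        · simp [B, hkJ]
        · have : p k ≠ m := fun h => hk (hpinj k _ hkJ (h.trans (hr m).symm))
          simp [B, hkJ, this]
      have hjr : j ≠ r m := by rintro h; exact hi (h ▸ hj)
      have hXu : ∀ t, X (update y m t) = update (X y) (r m) t := by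
        intro t
        have hne : ∀ k, k ≠ r m → k ≠ j → X (update y m t) k = X y k := by
          intro k hk hkj
          simp only [X]
          rw [update_of_ne hkj, update_of_ne hkj, hBu t k hk]
        have hτe : τ (B (update y m t)) (update y m t 0) = τ (B y) (y 0) := by
          apply hGinj j hj (B y)
          simp only [hτ]
          rw [← update_of_ne (Ne.symm hm) t y, ← hτ (B (update y m t)) (update y m t 0)]
          apply hG
          intro k hk
          by_cases hkj : k = j
          · subst hkj
            simp [hτ]
          · rw [update_of_ne hkj, update_of_ne hkj, hBu t k (by rintro rfl; exact hi hk)]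
        ext k
        by_cases hk : k = r m
        · subst hk
          rw [hX _ _ hi, hr, update_self, update_self]
        · rw [update_of_ne hk]
          by_cases hkj : k = j
          · subst hkj
            simp only [X, update_self, hτe]
          · rw [hne k hk hkj]
      rw [hXu, hXu] at hst
      exact hinj _ _ hst
  · intro m
    rw [isQuasigroup_iff_injective]
    rintro ⟨i, hi⟩ w s t hst
    by_cases hm : m = 0
    · have hiJ : i ∈ J := (hp0 i).mp (hi.trans hm)
      simp only [q, hm, if_true] at hst
      subst hm
      refine hGinj i hiJ (fun i => if hi : p i = 0 then w ⟨i, hi⟩ else 0) ?_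
      convert hst using 2 with u u
      all_goals
        ext k
        by_cases hk : k = i
        · subst hk; simp [hi]
        · by_cases hkp : p k = 0 <;> simp [hk, hkp]
    · have hri : r m = i :=
        hpinj _ _ (fun h => hm ((hr m) ▸ (hp0 _).mpr h)) ((hr m).trans hi.symm)
      subst hri
      simpa [q, hm] using hst
  · intro x
    refine hGh _ _ ?_ ?_
    · intro i hi
      refine Eq.trans ?_ (hX (fun j => q j fun i => x i.1) i hi).symm
      have hpi : p i ≠ 0 := fun h => hi ((hp0 i).mp h)
      have hri : i = r (p i) := hpinj i _ hi (hr _).symm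
      simp only [q, if_neg hpi]
      rw [← hri]
    · refine Eq.trans ?_ (hXG fun j => q j fun i => x i.1).symm
      simp only [q, if_true]
      apply hG
      intro i hi
      simp [(hp0 i).mpr hi]

/-- A quasigroup is reducible if one of its parastrophes splits off a proper part of at least two
variables. -/
theorem IsQuasigroup.isReducible_of_splitsOff_parastrophe {h : Word (Fin n) → Alphabet}
    (hh : IsQuasigroup h) (l : Fin n) {I : Finset (Fin n)} (hI : 2 ≤ I.card) (hIn : I.card < n)
    (hs : SplitsOff (parastrophe h l) I) : IsReducible h := by
  -- In the relation `z = h x`, the parastrophe has `z` in place `l` and `x l` as its value. If `l ∈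
  -- I`, then `z` is grouped with the letters of `I` other than `l`, and `x l` with the letters
  -- outside `I`; the inner function therefore uses the complement of `I` together with `l`.
  by_cases hl : l ∈ I
  · have hc : (insert l Iᶜ).card = n - I.card + 1 := by
      rw [Finset.card_insert_of_notMem (by simpa using hl), Finset.card_compl, Fintype.card_fin]
    have hmem2 : ∀ i ∈ I, i ≠ l → i ∉ insert l Iᶜ := by
      intro i hi hil
      simp [hi, hil]
    refine hh.isReducible (J := insert l Iᶜ) (by omega) (by omega)
      (fun x => h ((insert l Iᶜ).piecewise x 0)) ?_ ?_
    · intro x y hxy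
      congr 1
      ext i
      by_cases hi : i ∈ insert l Iᶜ
      · simp only [Finset.piecewise_eq_of_mem _ _ _ hi, hxy i hi]
      · simp only [Finset.piecewise_eq_of_notMem _ _ _ hi]
    · intro x y hxy hG
      have e1 := hh.parastrophe_update l ((insert l Iᶜ).piecewise x 0)
      have e2 := hh.parastrophe_update l ((insert l Iᶜ).piecewise y 0)
      have e3 := hh.parastrophe_update l x
      rw [← hG] at e2
      symm
      rw [hh.apply_eq_iff l]
      simp only [Finset.mem_insert, true_or, Finset.piecewise_eq_of_mem] at e1 e2
      rw [← e2]
      refine ((hs _ _ _ _ ?_ ?_ ?_ ?_).mp (e1.trans e3.symm)).symm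
      · intro i hi
        have hil : i ≠ l := by rintro rfl; exact hi hl
        simp [hi, hil]
      · intro i hi
        have hil : i ≠ l := by rintro rfl; exact hi hl
        simp [hi, hil]
      · intro i hi
        by_cases hil : i = l
        · subst hil; simp
        · simp [hi, hil]
      · intro i hi
        by_cases hil : i = l
        · subst hil; simp
        · simp [hil, hxy i (hmem2 i hi hil)]
  · refine hh.isReducible hI hIn (fun x => parastrophe h l (I.piecewise x 0)) ?_ ?_
    · intro x y hxy
      congr 1
      ext i
      by_cases hi : i ∈ I
      · simp [hi, hxy i hi]
      · simp [hi]
    · intro x y hxy hG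
      symm
      rw [hh.apply_eq_iff l, ← hxy l hl, ← hh.parastrophe_update l x]
      refine ((hs _ _ _ _ ?_ ?_ ?_ ?_).mp hG).symm
      · intro i hi
        simp [hi]
      · intro i hi
        by_cases hil : i = l
        · subst hil; simp
        · simp [hil, hxy i hi]
      · intro i hi
        have : i ≠ l := by rintro rfl; exact hl hi
        simp [hi, this]
      · intro i hi
        have : i ≠ l := by rintro rfl; exact hl hi
        simp [hi, this]

end Reducibility

/-! ### Counting components -/

section Components

variable {ι : Type} [DecidableEq ι] [Fintype ι]

/-- The number of words of `X` in the face through `u` with the directions from `I`. -/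
def faceCard (X : Finset (Word ι)) (I : Finset ι) (u : Word ι) : ℕ :=
  (X.filter fun v => ∀ i ∉ I, v i = u i).card

/-- A word of `X` has a partner in `X` in direction `j`, and the parallel face through the partner
is disjoint from the first. -/
theorem faceCard_insert {X : Finset (Word ι)}
    (hX : ∀ u ∈ X, ∀ i, ∃ t, t ≠ u i ∧ update u i t ∈ X) {I : Finset ι} {j : ι} (hj : j ∉ I)
    {m : ℕ} (hm : ∀ u ∈ X, m ≤ faceCard X I u) {u : Word ι} (hu : u ∈ X) :
    faceCard X I u + m ≤ faceCard X (insert j I) u := by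
  obtain ⟨t, ht, hut⟩ := hX u hu j
  have hd : Disjoint (X.filter fun v => ∀ i ∉ I, v i = u i)
      (X.filter fun v => ∀ i ∉ I, v i = update u j t i) := by
    rw [Finset.disjoint_left]
    intro v hv hv'
    have h1 := (Finset.mem_filter.mp hv).2 j hj
    have h2 := (Finset.mem_filter.mp hv').2 j hj
    rw [update_self] at h2
    exact ht (h2.symm.trans h1)
  refine (Nat.add_le_add_left (hm _ hut) _).trans ?_
  unfold faceCard
  rw [← Finset.card_union_of_disjoint hd]
  refine Finset.card_le_card ?_
  intro v hv
  simp only [Finset.mem_union, Finset.mem_filter, Finset.mem_insert, not_or] at hv ⊢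
  rcases hv with hv | hv
  · exact ⟨hv.1, fun i hi => hv.2 i hi.2⟩
  · exact ⟨hv.1, fun i hi => by rw [hv.2 i hi.2, update_of_ne hi.1]⟩

theorem two_pow_le_faceCard {X : Finset (Word ι)}
    (hX : ∀ u ∈ X, ∀ i, ∃ t, t ≠ u i ∧ update u i t ∈ X) (I : Finset ι) :
    ∀ u ∈ X, 2 ^ I.card ≤ faceCard X I u := by
  induction I using Finset.induction_on with
  | empty =>
    intro u hu
    rw [Finset.card_empty, pow_zero]
    exact Finset.card_pos.mpr ⟨u, by simp [hu]⟩
  | insert j I hj ih =>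
    intro u hu
    rw [Finset.card_insert_of_notMem hj, pow_succ, mul_two]
    exact (Nat.add_le_add_right (ih u hu) _).trans (faceCard_insert hX hj ih hu)

theorem faceCard_univ (X : Finset (Word ι)) (u : Word ι) : faceCard X Finset.univ u = X.card := by
  simp [faceCard]

/-- An excess over the minimum in one face survives as the remaining directions are added. -/
theorem two_pow_lt_card {X : Finset (Word ι)}
    (hX : ∀ u ∈ X, ∀ i, ∃ t, t ≠ u i ∧ update u i t ∈ X) {I : Finset ι} {u : Word ι} (hu : u ∈ X)
    (hI : 2 ^ I.card < faceCard X I u) : 2 ^ Fintype.card ι < X.card := by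
  have key : ∀ T : Finset ι, 2 ^ (T ∪ I).card < faceCard X (T ∪ I) u := by
    intro T
    induction T using Finset.induction_on with
    | empty => simpa using hI
    | insert j T _ ih =>
      rw [Finset.insert_union]
      by_cases hj : j ∈ T ∪ I
      · rwa [Finset.insert_eq_of_mem hj]
      · rw [Finset.card_insert_of_notMem hj, pow_succ, mul_two]
        exact (Nat.add_lt_add_right ih _).trans_le
          (faceCard_insert hX hj (two_pow_le_faceCard hX _) hu)
  have := key Finset.univ
  rwa [Finset.union_eq_left.mpr (Finset.subset_univ I), faceCard_univ, Finset.card_univ] at this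

variable {χ : Word ι → Bool}

/-- The words of the colour `true`, up to chains of steps. -/
def componentSetoid (χ : Word ι → Bool) : Setoid {u : Word ι // χ u = true} where
  r u v := Reach χ Finset.univ u.1 v.1
  iseqv := ⟨fun _ => .refl, fun h => Reach.symm h, fun h h' => h.trans h'⟩

/-- The connected components of the words of the colour `true`. -/
abbrev Component (χ : Word ι → Bool) : Type := Quotient (componentSetoid χ)

/-- Pairs of a word and a letter are counted twice, using the involution that exchanges the letter
with the one at `i`. -/
theorem IsBalanced.four_mul_card (hχ : IsBalanced χ) [Nonempty ι] :
    4 * (Finset.univ.filter fun u : Word ι => χ u = true).card = 2 * 4 ^ Fintype.card ι := by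
  obtain ⟨i⟩ := ‹Nonempty ι›
  have hinv : Involutive fun p : Word ι × Alphabet => (update p.1 i p.2, p.1 i) := by
    intro p
    simp
  have h1 : ∑ p : Word ι × Alphabet, (if χ (update p.1 i p.2) = true then 1 else 0) =
      ∑ p : Word ι × Alphabet, (if χ p.1 = true then 1 else 0) :=
    Equiv.sum_comp hinv.toPerm fun p : Word ι × Alphabet => if χ p.1 = true then 1 else 0
  rw [Fintype.sum_prod_type, Fintype.sum_prod_type_right] at h1
  simp only [← Finset.card_filter, hχ i _ true] at h1
  simp only [Finset.sum_const, Finset.card_univ, Fintype.card_fin, smul_eq_mul,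
    Fintype.card_pi, Finset.prod_const] at h1
  omega

/-- Each of the four parallel lines contributes two words, so there are at least eight. -/
theorem IsBalanced.four_lt_faceCard (hχ : IsBalanced χ) {i j : ι} (hij : i ≠ j) {α : Word ι}
    {X : Finset (Word ι)} (hX : ∀ v, (∀ k ∉ ({i, j} : Finset ι), v k = α k) → χ v = true → v ∈ X) :
    4 < faceCard X {i, j} α := by
  unfold faceCard
  rw [Finset.card_eq_sum_card_fiberwise (f := fun v => v j) (t := Finset.univ)
    (fun _ _ => Finset.mem_coe.mpr (Finset.mem_univ _))]
  refine lt_of_lt_of_le (by simp : 4 < ∑ _t : Alphabet, 2) (Finset.sum_le_sum fun t _ => ?_)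
  rw [← hχ i (update α j t) true,
    ← Finset.card_image_of_injective _ (update_injective (update α j t) i)]
  refine Finset.card_le_card ?_
  intro v hv
  obtain ⟨s, hs, rfl⟩ := Finset.mem_image.mp hv
  have hs := (Finset.mem_filter.mp hs).2
  have hoff : ∀ k ∉ ({i, j} : Finset ι), update (update α j t) i s k = α k := by
    intro k hk
    simp only [Finset.mem_insert, Finset.mem_singleton, not_or] at hk
    rw [update_of_ne hk.1, update_of_ne hk.2]
  simp only [Finset.mem_filter]
  exact ⟨⟨hX _ hoff hs, hoff⟩, by rw [update_of_ne hij.symm, update_self]⟩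

/-- With `m = Fintype.card ι`, the colour has `4 ^ m / 2` words and each component at least `2 ^ m`;
the component containing this colour class of the connected face has strictly more. -/
theorem FaceConnected.card_component_lt (hχ : IsBalanced χ) {i j : ι} (hij : i ≠ j) {α : Word ι}
    (hα : FaceConnected χ {i, j} α) : Nat.card (Component χ) < 2 ^ (Fintype.card ι - 1) := by
  classical
  have : Nonempty ι := ⟨i⟩
  have hX : ∀ u : Word ι, χ u = true →
      ∀ v ∈ (Finset.univ.filter fun v => Reach χ Finset.univ u v), ∀ i, ∃ t, t ≠ v i ∧
        update v i t ∈ (Finset.univ.filter fun v => Reach χ Finset.univ u v) := by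
    intro u hu v hv i
    obtain ⟨t, ht, hvt⟩ := hχ.exists_ne i v
    have hv := (Finset.mem_filter.mp hv).2
    exact ⟨t, ht, by simpa using hv.tail ⟨i, by simp, t, rfl, hvt⟩⟩
  have hfib : ∀ u : {u : Word ι // χ u = true},
      (Finset.univ.filter fun v => Reach χ Finset.univ u.1 v).card ≤
      (Finset.univ.filter fun v => (⟦v⟧ : Component χ) = ⟦u⟧).card := by
    intro u
    rw [← Finset.card_image_of_injective _ Subtype.val_injective]
    refine Finset.card_le_card ?_
    intro v hv
    have hv := (Finset.mem_filter.mp hv).2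
    refine Finset.mem_image.mpr ⟨⟨v, hv.colour_eq ▸ u.2⟩, ?_, rfl⟩
    simp only [Finset.mem_filter, Finset.mem_univ, true_and]
    exact Quotient.sound hv.symm
  have hsum : Fintype.card {u : Word ι // χ u = true} =
      ∑ q : Component χ, (Finset.univ.filter fun v => (⟦v⟧ : Component χ) = q).card := by
    rw [← Finset.card_univ]
    exact Finset.card_eq_sum_card_fiberwise fun _ _ => Finset.mem_coe.mpr (Finset.mem_univ _)
  have hle : ∀ q : Component χ, 2 ^ Fintype.card ι ≤
      (Finset.univ.filter fun v => (⟦v⟧ : Component χ) = q).card := by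
    intro q
    induction q using Quotient.inductionOn with
    | h u =>
      refine le_trans ?_ (hfib u)
      rw [← faceCard_univ _ u.1, ← Finset.card_univ]
      exact two_pow_le_faceCard (hX u.1 u.2) _ _ (by simpa using Relation.ReflTransGen.refl)
  obtain ⟨t, ht⟩ := hχ.exists_colour i α true
  have hoff : ∀ k ∉ ({i, j} : Finset ι), update α i t k = α k := by
    intro k hk
    simp only [Finset.mem_insert, Finset.mem_singleton, not_or] at hk
    rw [update_of_ne hk.1]
  have hlt : 2 ^ Fintype.card ι < (Finset.univ.filter fun v : {u : Word ι // χ u = true} =>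
      (⟦v⟧ : Component χ) = ⟦⟨update α i t, ht⟩⟧).card := by
    refine lt_of_lt_of_le ?_ (hfib _)
    refine two_pow_lt_card (hX _ ht) (I := {i, j}) (u := update α i t)
      (by simpa using Relation.ReflTransGen.refl) ?_
    rw [Finset.card_pair hij]
    refine hχ.four_lt_faceCard hij ?_
    intro v hv hvt
    simp only [Finset.mem_filter, Finset.mem_univ, true_and]
    refine (hα _ _ hoff (fun k hk => (hv k hk).trans (hoff k hk)) (ht.trans hvt.symm)).mono ?_
    exact Finset.subset_univ _
  have hlt' := Finset.sum_lt_sum (fun q (_ : q ∈ (Finset.univ : Finset (Component χ))) => hle q)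
    ⟨_, Finset.mem_univ _, hlt⟩
  rw [← hsum, Finset.sum_const, Finset.card_univ, smul_eq_mul, Fintype.card_subtype] at hlt'
  have h4 := hχ.four_mul_card
  rw [Nat.card_eq_fintype_card]
  obtain ⟨m, hm⟩ : ∃ m, Fintype.card ι = m + 1 := ⟨Fintype.card ι - 1, by
    have := Fintype.card_pos (α := ι); omega⟩
  rw [hm] at h4 hlt' ⊢
  have e : (4 : ℕ) ^ (m + 1) = 2 ^ (m + 1) * 2 ^ (m + 1) := by
    rw [← mul_pow]
    norm_num
  rw [e, pow_succ 2 m] at h4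
  rw [pow_succ 2 m] at hlt'
  rw [Nat.add_sub_cancel]
  refine lt_of_mul_lt_mul_right (a := 2 ^ m * 2 * 4) ?_ (Nat.zero_le _)
  nlinarith

theorem FaceConnected.card_component_le_one {α : Word ι} (h : FaceConnected χ Finset.univ α) :
    Nat.card (Component χ) ≤ 1 := by
  rw [Finite.card_le_one_iff_subsingleton]
  refine ⟨fun p q => ?_⟩
  induction p using Quotient.inductionOn with
  | h p =>
    induction q using Quotient.inductionOn with
    | h q => exact Quotient.sound (h _ _ (by simp) (by simp) (p.2.trans q.2.symm))

end Components

/-! ### Upper bound for the number of agreeing quasigroups -/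

section Agreeing

variable {n : ℕ} {h f : Word (Fin n) → Alphabet} {a b c d : Alphabet}

theorem ne_of_insert_eq_univ (habcd : ({a, b, c, d} : Set Alphabet) = Set.univ) :
    a ≠ b ∧ a ≠ c ∧ a ≠ d ∧ b ≠ c ∧ b ≠ d ∧ c ≠ d := by
  have h : ∀ x : Alphabet, x = a ∨ x = b ∨ x = c ∨ x = d := by
    intro x
    have : x ∈ ({a, b, c, d} : Set Alphabet) := habcd ▸ Set.mem_univ x
    simpa using this
  clear habcd
  revert a b c d
  decide

theorem mem_pair_iff (habcd : ({a, b, c, d} : Set Alphabet) = Set.univ) (x : Alphabet) :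
    x ∈ ({a, b} : Set Alphabet) ↔ ¬ (x = c ∨ x = d) := by
  obtain ⟨-, h2, h3, h4, h5, -⟩ := ne_of_insert_eq_univ habcd
  have : x ∈ ({a, b, c, d} : Set Alphabet) := habcd ▸ Set.mem_univ x
  simp only [Set.mem_insert_iff, Set.mem_singleton_iff] at this ⊢
  constructor
  · rintro (rfl | rfl) <;> simp_all
  · tauto

/-- The last coordinate. -/
abbrev lastIndex (hn : 1 ≤ n) : Fin n := ⟨n - 1, by omega⟩

theorem parastrophe_eq_of_mem_agreeing {hn : 1 ≤ n} (hh : IsQuasigroup h)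
    (habcd : ({a, b, c, d} : Set Alphabet) = Set.univ) (hf : f ∈ agreeingQuasigroups hn h a b)
    (u : Word (Fin n)) (hu : valueColour (parastrophe h (lastIndex hn)) c d u = false) :
    parastrophe f (lastIndex hn) u = parastrophe h (lastIndex hn) u := by
  rw [hf.1.parastrophe_eq_iff, hf.2]
  · exact hh.apply_parastrophe _ _
  · rw [mem_pair_iff habcd]
    simpa [valueColour] using hu

theorem valueColour_parastrophe_of_mem_agreeing {hn : 1 ≤ n} (hh : IsQuasigroup h)
    (habcd : ({a, b, c, d} : Set Alphabet) = Set.univ) (hf : f ∈ agreeingQuasigroups hn h a b)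
    (u : Word (Fin n)) : valueColour (parastrophe f (lastIndex hn)) c d u =
      valueColour (parastrophe h (lastIndex hn)) c d u := by
  by_cases hu : valueColour (parastrophe h (lastIndex hn)) c d u = false
  · rw [valueColour, parastrophe_eq_of_mem_agreeing hh habcd hf u hu]
    rfl
  · rw [Bool.not_eq_false] at hu
    rw [hu]
    by_contra hfu
    have hfu' : ¬ (parastrophe f (lastIndex hn) u = c ∨ parastrophe f (lastIndex hn) u = d) := by
      simpa [valueColour] using hfu
    have h1 := hf.1.apply_parastrophe (lastIndex hn) u
    rw [hf.2 _ (by rw [update_self]; exact (mem_pair_iff habcd _).mpr hfu'),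
      ← hh.parastrophe_eq_iff] at h1
    rw [← h1] at hfu'
    simp [valueColour] at hu
    exact hfu' hu

theorem IsQuasigroup.ext_parastrophe {f g : Word (Fin n) → Alphabet} (hf : IsQuasigroup f)
    (hg : IsQuasigroup g) (l : Fin n) (hfg : ∀ u, parastrophe f l u = parastrophe g l u) :
    f = g := by
  ext1 x
  rw [hf.apply_eq_iff l, hfg, hg.parastrophe_update]

/-- A step that changes the word within the colour `true` exchanges `c` and `d` for both
parastrophes, so agreement at one word spreads over its component. The set of components of
agreement then determines `f`. -/
theorem ncard_agreeingQuasigroups_le {hn : 1 ≤ n} (hh : IsQuasigroup h)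
    (habcd : ({a, b, c, d} : Set Alphabet) = Set.univ) :
    (agreeingQuasigroups hn h a b).ncard ≤
      2 ^ Nat.card (Component (valueColour (parastrophe h (lastIndex hn)) c d)) := by
  classical
  obtain ⟨-, -, -, -, -, hcd⟩ := ne_of_insert_eq_univ habcd
  set l := lastIndex hn with hl
  set χ := valueColour (parastrophe h l) c d with hχ
  have hstep : ∀ f ∈ agreeingQuasigroups hn h a b, ∀ u v, χ u = true → Reach χ Finset.univ u v →
      (parastrophe f l u = parastrophe h l u ↔ parastrophe f l v = parastrophe h l v) := by
    intro f hf u v hu huv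
    induction huv with
    | refl => rfl
    | @tail v w huv hvw ih =>
      have hv : χ v = true := by rw [← Reach.colour_eq huv, hu]
      obtain ⟨i, -, t, rfl, hc⟩ := hvw
      rw [ih]
      by_cases ht : t = v i
      · rw [ht, update_eq_self]
      have hne : ∀ g : Word (Fin n) → Alphabet, IsQuasigroup g →
          parastrophe g l v ≠ parastrophe g l (update v i t) := by
        intro g hg h
        have := isQuasigroup_iff_injective.mp (hg.isQuasigroup_parastrophe l) i v
        exact ht (this (by simpa using h)).symm
      have h1 := hne f hf.1
      have h2 := hne h hh
      have hfv := valueColour_parastrophe_of_mem_agreeing hh habcd hf v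
      have hfw := valueColour_parastrophe_of_mem_agreeing hh habcd hf (update v i t)
      rw [← hl, ← hχ] at hfv hfw
      rw [hc, hv] at hfw
      rw [hv] at hfv
      rw [hv] at hc
      rw [hχ] at hc hv
      simp only [valueColour, decide_eq_true_eq] at hfv hfw hc hv
      grind
  let F : (Word (Fin n) → Alphabet) → Set (Component χ) := fun f =>
    {q | ∃ u : {u // χ u = true}, ⟦u⟧ = q ∧ parastrophe f l u.1 = parastrophe h l u.1}
  have hF : ∀ f ∈ agreeingQuasigroups hn h a b, ∀ u : {u // χ u = true},
      ⟦u⟧ ∈ F f ↔ parastrophe f l u.1 = parastrophe h l u.1 := by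
    intro f hf u
    constructor
    · rintro ⟨v, hvu, hv⟩
      exact (hstep f hf v.1 u.1 v.2 (Quotient.exact hvu)).mp hv
    · intro hu
      exact ⟨u, rfl, hu⟩
  have hinj : Set.InjOn F (agreeingQuasigroups hn h a b) := by
    intro f hf g hg hfg
    refine hf.1.ext_parastrophe hg.1 l fun u => ?_
    by_cases hu : χ u = false
    · rw [parastrophe_eq_of_mem_agreeing hh habcd hf u hu,
        parastrophe_eq_of_mem_agreeing hh habcd hg u hu]
    rw [Bool.not_eq_false] at hu
    have h1 := hF f hf ⟨u, hu⟩
    rw [hfg, hF g hg] at h1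
    have hfu := valueColour_parastrophe_of_mem_agreeing hh habcd hf u
    have hgu := valueColour_parastrophe_of_mem_agreeing hh habcd hg u
    rw [← hl, ← hχ, hu] at hfu hgu
    rw [hχ] at hu
    simp only [valueColour, decide_eq_true_eq] at hfu hgu hu
    grind
  have h1 := Set.ncard_le_ncard_of_injOn F (t := Set.univ) (fun _ _ => Set.mem_univ _) hinj
    Set.finite_univ
  rw [Set.ncard_univ] at h1
  simpa [Nat.card_eq_fintype_card] using h1

end Agreeing

/-! ### Colourings that split in every direction -/

section Linear

variable {ι : Type} [DecidableEq ι]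

theorem SplitsOff.colour_update_iff {χ : Word ι → Bool} {i : ι} (h : SplitsOff χ {i})
    (u v : Word ι) (s t : Alphabet) :
    χ (update u i s) = χ (update u i t) ↔ χ (update v i s) = χ (update v i t) := by
  apply h
  · intro k hk
    rw [Finset.mem_singleton] at hk
    rw [update_of_ne hk, update_of_ne hk]
  · intro k hk
    rw [Finset.mem_singleton] at hk
    rw [update_of_ne hk, update_of_ne hk]
  · intro k hk
    rw [Finset.mem_singleton] at hk
    subst hk
    simp
  · intro k hk
    rw [Finset.mem_singleton] at hk
    subst hk
    simp

/-- The colour as a residue modulo `2`. -/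
def Bool.toZModTwo (b : Bool) : ZMod 2 := if b then 1 else 0

theorem Finset.sum_update_apply [Fintype ι] (c : ι → Alphabet → ZMod 2) (u : Word ι) (j : ι)
    (t : Alphabet) :
    ∑ i, c i (update u j t i) = c j t + ∑ i ∈ Finset.univ.erase j, c i (u i) := by
  rw [← Finset.add_sum_erase _ _ (Finset.mem_univ j), update_self]
  congr 1
  refine Finset.sum_congr rfl fun i hi => ?_
  rw [update_of_ne (Finset.ne_of_mem_erase hi)]

/-- Whether changing one letter changes the colour does not depend on the other letters, so it can
be read off at `o`; `K` makes the formula right at `o` itself. -/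
theorem exists_toZModTwo_eq_sum [Fintype ι] {χ : Word ι → Bool} (h : ∀ i, SplitsOff χ {i})
    (o : Word ι) :
    ∃ K, ∀ u, (χ u).toZModTwo = ∑ i, (χ (update o i (u i))).toZModTwo + K := by
  refine ⟨(χ o).toZModTwo - ∑ i, (χ (update o i (o i))).toZModTwo, ?_⟩
  refine word_induction o (by ring) ?_
  intro u j t hu
  rw [Finset.sum_update_apply (fun i t => (χ (update o i t)).toZModTwo)]
  rw [← Finset.add_sum_erase _ _ (Finset.mem_univ j)] at hu
  have h1 := (h j).colour_update_iff u o t (u j)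
  rw [update_eq_self] at h1
  generalize ∑ i ∈ Finset.univ.erase j, (χ (update o i (u i))).toZModTwo = A at *
  generalize (χ o).toZModTwo - ∑ i, (χ (update o i (o i))).toZModTwo = B at *
  generalize χ (update u j t) = p at *
  generalize χ u = q at *
  generalize χ (update o j t) = r at *
  generalize χ (update o j (u j)) = s at *
  revert A B p q r s
  decide

theorem line_inter_eq_image (i : ι) (x : Word ι) (S : Set (Word ι)) :
    line i x ∩ S = update x i '' {t | update x i t ∈ S} := by
  ext u
  constructor
  · rintro ⟨⟨t, rfl⟩, hu⟩
    exact ⟨t, hu, rfl⟩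
  · rintro ⟨t, ht, rfl⟩
    exact ⟨⟨t, rfl⟩, ht⟩

theorem ncard_line_inter (i : ι) (x : Word ι) (S : Set (Word ι)) :
    (line i x ∩ S).ncard = {t | update x i t ∈ S}.ncard := by
  rw [line_inter_eq_image, Set.ncard_image_of_injective _ (update_injective x i)]

theorem isLinearDoubleMDSCode_setOf_sum_eq_one [Fintype ι] {c : ι → Alphabet → ZMod 2}
    (hc : ∀ i b, (Finset.univ.filter fun t => c i t = b).card = 2) :
    IsLinearDoubleMDSCode {x : Word ι | ∑ i, c i (x i) = 1} := by
  constructor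
  · intro i x
    rw [ncard_line_inter]
    refine Eq.trans ?_ (hc i (1 - ∑ k ∈ Finset.univ.erase i, c k (x k)))
    rw [← Set.ncard_coe_finset]
    congr 1
    ext t
    simp [Finset.sum_update_apply, eq_sub_iff_add_eq]
  · refine ⟨c, fun x => ?_⟩
    simp only [chi, Set.mem_ofPred_eq]
    have key : ∀ s : ZMod 2, s ≠ 1 → 0 = s := by decide
    split_ifs with hs
    · exact hs.symm
    · exact key _ hs

theorem mem_graphCode {n : ℕ} {g : Word (Fin n) → Alphabet} {w : Word (Fin (n + 1))} :
    w ∈ graphCode g ↔ g (Fin.init w) = w (Fin.last n) := by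
  constructor
  · rintro ⟨x, rfl⟩
    simp
  · intro h
    refine ⟨Fin.init w, ?_⟩
    simp only [h]
    exact Fin.snoc_init_self w

theorem IsQuasigroup.isMDSCode_graphCode {n : ℕ} {g : Word (Fin n) → Alphabet}
    (hg : IsQuasigroup g) : IsMDSCode (graphCode g) := by
  intro i w
  rw [ncard_line_inter, Set.ncard_eq_one]
  suffices ∃! t, update w i t ∈ graphCode g by
    obtain ⟨t, ht, hu⟩ := this
    exact ⟨t, Set.eq_singleton_iff_unique_mem.mpr ⟨ht, hu⟩⟩
  simp only [mem_graphCode]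
  induction i using Fin.lastCases with
  | last => simp [Fin.init_update_last]
  | cast i =>
    simp only [Fin.init_update_castSucc, update_of_ne (Fin.castSucc_lt_last i).ne']
    exact hg i (Fin.init w) _

variable {n : ℕ} {h : Word (Fin n) → Alphabet} {a b c d : Alphabet}

theorem card_filter_toZModTwo {χ : Word ι → Bool} (hχ : IsBalanced χ) (o : Word ι) (i : ι)
    (b : ZMod 2) :
    (Finset.univ.filter fun t => (χ (update o i t)).toZModTwo = b).card = 2 := by
  refine Eq.trans ?_ (hχ i o (decide (b = 1)))
  congr 1
  ext t
  simp only [Finset.mem_filter, Finset.mem_univ, true_and]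
  generalize χ (update o i t) = p
  revert p b
  decide

theorem card_filter_pair (hcd : c ≠ d) (K b : ZMod 2) :
    (Finset.univ.filter fun t : Alphabet =>
      (decide (t = c ∨ t = d)).toZModTwo + K = b).card = 2 := by
  revert c d K b
  decide

theorem IsQuasigroup.isSemilinear (hh : IsQuasigroup h) (l : Fin n) (hcd : c ≠ d)
    (hs : ∀ i, SplitsOff (valueColour (_root_.parastrophe h l) c d) {i}) : IsSemilinear h := by
  refine ⟨hh.isMDSCode_graphCode, ?_⟩
  set χ := valueColour (_root_.parastrophe h l) c d with hχ
  have hb : IsBalanced χ := (hh.isQuasigroup_parastrophe l).isBalanced_valueColour hcd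
  obtain ⟨K, hK⟩ := exists_toZModTwo_eq_sum hs 0
  -- The value `h x` takes over the summand of the place `l`, while `x l`, now the value of the
  -- parastrophe, contributes the indicator of `{c, d}`. On the graph that indicator occurs twice
  -- and cancels; the shift `K + 1` makes the total `1`.
  refine ⟨_, isLinearDoubleMDSCode_setOf_sum_eq_one (c := fun i => Fin.lastCases
    (fun t => (χ (update 0 l t)).toZModTwo)
    (fun i t => if i = l then (decide (t = c ∨ t = d)).toZModTwo + (K + 1)
      else (χ (update 0 i t)).toZModTwo) i) ?_, ?_⟩
  · intro i b
    induction i using Fin.lastCases with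
    | last => simpa using card_filter_toZModTwo hb 0 l b
    | cast i =>
      simp only [Fin.lastCases_castSucc]
      split_ifs
      · exact card_filter_pair hcd _ _
      · exact card_filter_toZModTwo hb 0 i b
  · rintro _ ⟨x, rfl⟩
    simp only [Set.mem_ofPred_eq, Fin.sum_univ_castSucc, Fin.lastCases_castSucc, Fin.lastCases_last,
      Fin.snoc_castSucc, Fin.snoc_last]
    have h1 := hK (update x l (h x))
    rw [Finset.sum_update_apply (fun i t => (χ (update 0 i t)).toZModTwo)] at h1
    have h2 : χ (update x l (h x)) = decide (x l = c ∨ x l = d) := by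
      rw [hχ, valueColour, hh.parastrophe_update]
    rw [h2] at h1
    rw [← Finset.add_sum_erase _ _ (Finset.mem_univ l), if_pos rfl, Finset.sum_congr rfl
      (fun i hi => if_neg (Finset.ne_of_mem_erase hi)), h1]
    generalize ∑ i ∈ Finset.univ.erase l, (χ (update 0 i (x i))).toZModTwo = A
    generalize (χ (update 0 l (h x))).toZModTwo = B
    clear h1 hK
    revert A B K
    decide

/-- Each letter other than the last has one of two types, giving `2 ^ (n - 1)` type vectors; `c` and
`d` may be exchanged in the last argument independently for each vector. -/
theorem two_pow_le_ncard_agreeingQuasigroups {hn : 1 ≤ n} (hh : IsQuasigroup h)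
    (habcd : ({a, b, c, d} : Set Alphabet) = Set.univ)
    (hs : ∀ i, SplitsOff (valueColour (parastrophe h (lastIndex hn)) c d) {i}) :
    2 ^ 2 ^ (n - 1) ≤ (agreeingQuasigroups hn h a b).ncard := by
  classical
  obtain ⟨-, -, -, -, -, hcd⟩ := ne_of_insert_eq_univ habcd
  set l := lastIndex hn with hl
  set χ := valueColour (parastrophe h l) c d with hχ
  have hb : IsBalanced χ := (hh.isQuasigroup_parastrophe l).isBalanced_valueColour hcd
  have hinj := isQuasigroup_iff_injective.mp hh
  let σ : Bool → Equiv.Perm Alphabet := fun p => if p then Equiv.swap c d else 1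
  have hσ : ∀ p x, ¬ (x = c ∨ x = d) → σ p x = x := by
    intro p x hx
    rw [not_or] at hx
    cases p
    · rfl
    · exact Equiv.swap_apply_of_ne_of_ne hx.1 hx.2
  have hσ' : ∀ p x, (x = c ∨ x = d) → (σ p x = c ∨ σ p x = d) := by
    rintro p x (rfl | rfl) <;> cases p <;> simp [σ]
  have hσc : ∀ p q, σ p c = σ q c → p = q := by
    intro p q
    cases p <;> cases q <;> simp [σ, hcd, hcd.symm]
  let ty : Word (Fin n) → {i // i ≠ l} → Bool := fun x i => χ (update 0 i.1 (x i.1))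
  let F : (({i // i ≠ l} → Bool) → Bool) → Word (Fin n) → Alphabet :=
    fun φ x => h (update x l (σ (φ (ty x)) (x l)))
  have htyl : ∀ x t, ty (update x l t) = ty x := by
    intro x t
    ext i
    simp only [ty, update_of_ne i.2]
  have hF : ∀ φ, F φ ∈ agreeingQuasigroups hn h a b := by
    intro φ
    constructor
    · rw [isQuasigroup_iff_injective]
      intro i x s t hst
      simp only [F] at hst
      by_cases hil : i = l
      · subst hil
        simp only [htyl, update_self, update_idem] at hst
        exact (σ _).injective (hinj _ _ hst)
      rw [update_of_ne (Ne.symm hil), update_of_ne (Ne.symm hil), update_comm hil,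
        update_comm hil] at hst
      by_cases hx : x l = c ∨ x l = d
      · have hz := fun p => hσ' p _ hx
        -- With the common value written in place `l`, both words have the colour `true`. As
        -- direction `i` splits off, `s` and `t` have the same type, so both words undergo the same
        -- exchange and injectivity of `h` applies.
        have hcol : ∀ r, ∀ p, h (update (update x l (σ p (x l))) i r) =
            h (update (update x l (σ (φ (ty (update x i s))) (x l))) i s) →
            χ (update (update x l
              (h (update (update x l (σ (φ (ty (update x i s))) (x l))) i s))) i r) = true := by
          intro r p hp
          have : parastrophe h l (update (update x l
              (h (update (update x l (σ (φ (ty (update x i s))) (x l))) i s))) i r) =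
              σ p (x l) := by
            rw [hh.parastrophe_eq_iff, update_of_ne (Ne.symm hil), update_self,
              update_comm hil, update_idem, hp]
          rw [hχ, valueColour, this]
          simpa using hz p
        have h1 := hcol s _ rfl
        have h2 := hcol t _ hst.symm
        have h3 := ((hs i).colour_update_iff _ 0 s t).mp (h1.trans h2.symm)
        have h4 : ty (update x i s) = ty (update x i t) := by
          ext k
          by_cases hk : k.1 = i
          · simp only [ty, hk, update_self, h3]
          · simp only [ty, update_of_ne hk]
        rw [h4] at hst
        exact hinj _ _ hst
      · rw [hσ _ _ hx, hσ _ _ hx] at hst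
        exact hinj _ _ hst
    · intro x hx
      have := (mem_pair_iff habcd _).mp hx
      simp only [F]
      rw [hσ _ _ this, update_eq_self]
  have hFinj : Injective F := by
    intro φ ψ hφψ
    ext1 τ
    have hex : ∀ i : Fin n, ∀ p, ∃ t, χ (update 0 i t) = p := fun i p => hb.exists_colour i 0 p
    choose r hr using hex
    let x : Word (Fin n) := fun i => if hi : i = l then c else r i (τ ⟨i, hi⟩)
    have hx : ty x = τ := by
      ext i
      simp only [ty, x, dif_neg i.2, hr]
    have hxl : x l = c := by simp [x]
    have h1 := congrFun hφψ x
    simp only [F, hx, hxl] at h1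
    exact hσc _ _ (hinj _ _ h1)
  have h1 := Set.ncard_le_ncard (s := Set.range F) (t := agreeingQuasigroups hn h a b)
    (by rintro _ ⟨φ, rfl⟩; exact hF φ) (Set.toFinite _)
  rw [← Set.image_univ, Set.ncard_image_of_injective _ hFinj, Set.ncard_univ] at h1
  simpa [Nat.card_eq_fintype_card, Fintype.card_subtype_compl] using h1

end Linear

theorem mainTheorem8 (n : ℕ) (hn : 1 ≤ n) (h : Word (Fin n) → Alphabet) (hh : IsQuasigroup h)
    (a b c d : Alphabet) (habcd : ({a, b, c, d} : Set Alphabet) = Set.univ) :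
    ((2 < (agreeingQuasigroups hn h a b).ncard ∧
        (agreeingQuasigroups hn h a b).ncard < 2 ^ 2 ^ (n - 1)) → IsReducible h) ∧
      ((agreeingQuasigroups hn h a b).ncard = 2 ^ 2 ^ (n - 1) → IsSemilinear h) := by
  obtain ⟨-, -, -, -, -, hcd⟩ := ne_of_insert_eq_univ habcd
  have hg := hh.isQuasigroup_parastrophe (lastIndex hn)
  have hχ := hg.isBalanced_valueColour hcd
  have hle := ncard_agreeingQuasigroups_le (hn := hn) hh habcd
  rcases splitsOff_singleton_or_faceConnected hχ with hs | ⟨i, j, α, hij, hα⟩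
  · have := two_pow_le_ncard_agreeingQuasigroups hh habcd hs
    exact ⟨fun h => absurd h.2 this.not_gt, fun _ => hh.isSemilinear _ hcd hs⟩
  constructor
  · rintro ⟨h2, -⟩
    obtain ⟨J, hJ, hs, hc⟩ := hα.exists_splitsOff hχ (by simp)
    have hJ2 := Finset.card_le_card hJ
    rw [Finset.card_pair hij] at hJ2
    -- Connectedness in all directions would leave at most one component, hence at most two agreeing
    -- quasigroups.
    have hJn : J ≠ Finset.univ := by
      rintro rfl
      have := Nat.pow_le_pow_right Nat.two_pos (hc α).card_component_le_one
      omega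
    have hJn' : J.card < n := by
      simpa using Finset.card_lt_card (Finset.ssubset_univ_iff.mpr hJn)
    exact hh.isReducible_of_splitsOff_parastrophe _ hJ2 hJn' (hg.splitsOff hcd hs hc)
  · intro heq
    have h1 := hα.card_component_lt hχ hij
    rw [Fintype.card_fin] at h1
    exact absurd (heq ▸ hle) (Nat.pow_lt_pow_right Nat.one_lt_two h1).not_ge
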